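/- Let $G$ be a finite connected directed graph (multiple edges allowed, no loop edges), regarded as a topological space in which each edge is a copy of $[0,1]$, and let $p\colon\widetilde G\to G$ be its universal covering. We identify $\pi=\pi_1(G,x_0)$, $x_0$ a vertex, with the group of covering transformations of $p$. Choose a spanning tree $\mathcal T$ of $G$ rooted at $x_0$ and lift it to $\widetilde G$; this gives chosen lifts $\widetilde V$ of all vertices $V$ and $\widetilde E$ of all edges $E\in\mathcal T$. For an edge $E\notin\mathcal T$ let $\widetilde E$ be the lift starting at $\widetilde V$, where $V$ is the initial vertex of $E$. For a point $x$ in the interior of an edge $E$ let $\widetilde x$ be the point of $\widetilde E$ over $x$. Let $f\colon G\to G$ be a continuous map that is homotopic to the identity and permutes the vertices, and let $\widetilde f\colon\widetilde G\to\widetilde G$ be a lift of $f$ that commutes with all covering transformations. If $f^k(x)=x$ with $k\ge1$ and $\widetilde f^k(\widetilde x)=w\widetilde x$ with $w\in\pi$, the rotation element of $x$ is $\rho(x)=w^{1/k}$, where rational powers of elements of $\pi$ are formal expressions subject to $(w^j)^q=w^{jq}$ for $j\in\mathbb Z$, $q\in\mathbb Q$. An edge path is reduced if it contains no edge followed immediately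 by its reverse. A cyclic reduction of a closed edge path is a closed edge path obtained from it by changing the base point along the path and cancelling adjacent inverse edges, which is reduced and whose first edge is not the reverse of its last edge. An edge $E$ belongs to $w\in\pi$ if every cyclic reduction of every edge loop at $x_0$ representing $w$ uses $E$ or $E^{-1}$. Let $E$ be an edge of $\mathcal T$ with initial vertex $V_1$ and terminal vertex $V_2$. Suppose that $m,n\ge 1$, $f^m(V_1)=V_1$, $f^n(V_2)=V_2$, $\widetilde f^m(\widetilde V_1)=w_1\widetilde V_1$ and $\widetilde f^n(\widetilde V_2)=w_2\widetilde V_2$ with $w_1,w_2\in\pi$, so that $\rho(V_1)=w_1^{1/m}$ and $\rho(V_2)=w_2^{1/n}$. For $i=1,2$ let $\widetilde P_i$ be the shortest edge path in $\widetilde G$ from $\widetilde V_i$ to $w_i\widetilde V_i$. Theorem. Suppose that $E$ belongs to both $w_1$ and $w_2$, and that each of $\widetilde P_1$ and $\widetilde P_2$ begins with $\widetilde E$, i.e. its first edge is $\widetilde E$ or $\widetilde E^{-1}$. Then for all rational numbers $r,s$ with $0\le r<1/m$ and $0\le s<1/n$ there are periodic points $x$ and $y$ of $f$ in the (closed) edge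 $E$ with $\rho(x)=w_1^{\,r}$ and $\rho(y)=w_2^{\,s}$. -/

import Mathlib

open scoped unitInterval

/-- A directed graph, with multiple edges allowed. -/
structure Multigraph (V E : Type*) where
  /-- initial vertex of an edge -/
  src : E → V
  /-- terminal vertex of an edge -/
  tgt : E → V

namespace Multigraph

/-! ### Edge paths -/

/-- The same edge traversed in the opposite direction. A traversed edge is a pair `(e, b)`:
`(e, true)` is `e` itself, `(e, false)` is its reverse. -/
def rev {E : Type*} (s : E × Bool) : E × Bool := (s.1, !s.2)

section Walks

variable {V E : Type*} (Γ : Multigraph V E)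

/-- No edge is a loop. -/
def Loopless : Prop := ∀ e, Γ.src e ≠ Γ.tgt e

/-- The vertex at which a traversed edge starts. -/
def start (s : E × Bool) : V := if s.2 then Γ.src s.1 else Γ.tgt s.1

/-- The vertex at which a traversed edge ends. -/
def finish (s : E × Bool) : V := if s.2 then Γ.tgt s.1 else Γ.src s.1

/-- `P` is an edge path from `u` to `v`. -/
def IsWalk (u : V) (P : List (E × Bool)) (v : V) : Prop :=
  match P with
  | [] => u = v
  | s :: Q => Γ.start s = u ∧ IsWalk (Γ.finish s) Q v

/-- `P` is an edge path from `u` to `v` with the least possible number of edges. -/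
def IsShortestWalk (u : V) (P : List (E × Bool)) (v : V) : Prop :=
  Γ.IsWalk u P v ∧ ∀ Q, Γ.IsWalk u Q v → P.length ≤ Q.length

end Walks

/-- The edge path traverses no edge immediately followed by the same edge backwards. -/
def Reduced {E : Type*} (P : List (E × Bool)) : Prop :=
  List.IsChain (fun s t => t ≠ rev s) P

/-- The first edge of the path is `e` or the reverse of `e`. -/
def BeginsWith {E : Type*} (P : List (E × Bool)) (e : E) : Prop :=
  ∃ b Q, P = (e, b) :: Q

/-- The path uses `e` or the reverse of `e`. -/
def Uses {E : Type*} (P : List (E × Bool)) (e : E) : Prop :=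
  ∃ b, (e, b) ∈ P

/-- `T` is the edge set of a spanning tree: any two vertices are joined by exactly one reduced
edge path in `T`. -/
def IsSpanningTree {V E : Type*} (Γ : Multigraph V E) (T : Set E) : Prop :=
  ∀ u v, ∃! P, Γ.IsWalk u P v ∧ (∀ s ∈ P, s.1 ∈ T) ∧ Reduced P

/-! ### Cyclic reduction of edge loops -/

/-- Elementary moves on closed edge paths: change of base point, and cancellation of two adjacent
inverse edges. -/
inductive CyclicMove {E : Type*} : List (E × Bool) → List (E × Bool) → Prop
  | rotate (s : E × Bool) (P : List (E × Bool)) : CyclicMove (s :: P) (P ++ [s])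
  | cancel (P Q : List (E × Bool)) (s : E × Bool) : CyclicMove (P ++ s :: rev s :: Q) (P ++ Q)

/-- A reduced loop whose first edge is not the reverse of its last edge. -/
def CyclicallyReduced {E : Type*} (P : List (E × Bool)) : Prop :=
  Reduced P ∧ ∀ s ∈ P.head?, ∀ t ∈ P.getLast?, s ≠ rev t

/-- `C` is a cyclic reduction of the loop `P`. -/
def IsCyclicReduction {E : Type*} (P C : List (E × Bool)) : Prop :=
  Relation.ReflTransGen CyclicMove P C ∧ CyclicallyReduced C

/-! ### The graph as a topological space -/

section Realization

variable {V E : Type*} (Γ : Multigraph V E)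

/-- The ends of the unit interval belonging to an edge are glued to the end vertices. -/
inductive Glue : V ⊕ (Σ _ : E, I) → V ⊕ (Σ _ : E, I) → Prop
  | src (e : E) : Glue (Sum.inr ⟨e, 0⟩) (Sum.inl (Γ.src e))
  | tgt (e : E) : Glue (Sum.inr ⟨e, 1⟩) (Sum.inl (Γ.tgt e))

/-- The topological graph: the vertices together with one unit interval for each edge, glued
along the end points. -/
def Space : Type _ := Quot Γ.Glue

/-- Quotient topology of the disjoint union of the discrete vertex set and the intervals. -/
instance : TopologicalSpace Γ.Space :=
  letI : TopologicalSpace V := ⊥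
  inferInstanceAs (TopologicalSpace (Quot Γ.Glue))

/-- A vertex as a point of the topological graph. -/
def vertexPt (v : V) : Γ.Space := Quot.mk _ (Sum.inl v)

/-- The point with parameter `t` on the edge `e`. -/
def edgePt (e : E) (t : I) : Γ.Space := Quot.mk _ (Sum.inr ⟨e, t⟩)

/-- The edge `e`, with its end points, as a subset of the topological graph. -/
def edgeSet (e : E) : Set Γ.Space := Set.range (Γ.edgePt e)

theorem edgePt_zero (e : E) : Γ.edgePt e 0 = Γ.vertexPt (Γ.src e) := Quot.sound (Glue.src e)

theorem edgePt_one (e : E) : Γ.edgePt e 1 = Γ.vertexPt (Γ.tgt e) := Quot.sound (Glue.tgt e)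

end Realization

/-! ### The covering graph and covering transformations -/

section Cover

variable {V E X : Type*} [TopologicalSpace X] (Γ : Multigraph V E) (p : X → Γ.Space)

/-- The vertices of the covering space: the points lying over a vertex of the graph. -/
def CoverVertex : Type _ := {x : X // ∃ v, p x = Γ.vertexPt v}

/-- The edges of the covering space: the lifts of the edges of the graph. -/
structure CoverEdge where
  /-- the edge of the graph that is lifted -/
  base : E
  /-- the lifted edge, parametrized -/
  path : C(I, X)
  proj : ∀ t, p (path t) = Γ.edgePt base t

/-- The graph structure of the covering space. -/
def coverGraph : Multigraph (Γ.CoverVertex p) (Γ.CoverEdge p) where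
  src c := ⟨c.path 0, Γ.src c.base, (c.proj 0).trans (Γ.edgePt_zero c.base)⟩
  tgt c := ⟨c.path 1, Γ.tgt c.base, (c.proj 1).trans (Γ.edgePt_one c.base)⟩

/-- The group of covering transformations of `p`. -/
def Deck {X Y : Type*} [TopologicalSpace X] (p : X → Y) : Subgroup (X ≃ₜ X) where
  carrier := {g | ∀ x, p (g x) = p x}
  mul_mem' {g h} hg hh x := (hg (h x)).trans (hh x)
  one_mem' _ := rfl
  inv_mem' {g} hg x := by
    have h := hg (g.symm x)
    rw [Homeomorph.apply_symm_apply] at h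
    exact h.symm

variable {Γ p}

/-- Action of covering transformations on the vertices of the covering space. -/
def moveVertex (w : Deck p) (x : Γ.CoverVertex p) : Γ.CoverVertex p :=
  ⟨w.1 x.1, by
    obtain ⟨v, hv⟩ := x.2
    exact ⟨v, (w.2 x.1).trans hv⟩⟩

variable (Γ p)

/-- A coherent labeling of the covering space. A spanning tree `tree` with a root is lifted as a
whole; this gives the chosen lifts of all vertices and of the edges of the tree. The chosen lift
of any other edge starts at the chosen lift of its initial vertex. -/
structure CoherentLabeling where
  root : V
  tree : Set E
  tree_spanning : Γ.IsSpanningTree tree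
  vert : V → Γ.CoverVertex p
  vert_proj : ∀ v, p (vert v).1 = Γ.vertexPt v
  edge : E → Γ.CoverEdge p
  edge_base : ∀ e, (edge e).base = e
  edge_src : ∀ e, (Γ.coverGraph p).src (edge e) = vert (Γ.src e)
  edge_tgt : ∀ e ∈ tree, (Γ.coverGraph p).tgt (edge e) = vert (Γ.tgt e)

namespace CoherentLabeling

variable {Γ p} (L : Γ.CoherentLabeling p)

open Classical in
/-- The chosen lift of a point of the graph: for a vertex the chosen vertex over it, for a point
in the interior of an edge the point over it on the chosen lift of the edge. -/
noncomputable def lift : Γ.Space → X :=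
  Quot.lift
    (fun a => match a with
      | Sum.inl v => (L.vert v).1
      | Sum.inr ⟨e, t⟩ =>
          if t = 0 then (L.vert (Γ.src e)).1
          else if t = 1 then (L.vert (Γ.tgt e)).1
          else (L.edge e).path t)
    (by
      intro a b h
      cases h with
      | src e => simp
      | tgt e => simp)

theorem proj_lift (x : Γ.Space) : p (L.lift x) = x := by
  classical
  induction x using Quot.ind with
  | mk a =>
    rcases a with v | ⟨e, t⟩
    · exact L.vert_proj v
    · show p (if t = 0 then (L.vert (Γ.src e)).1
          else if t = 1 then (L.vert (Γ.tgt e)).1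
          else (L.edge e).path t) = Γ.edgePt e t
      split_ifs with h0 h1
      · rw [h0, L.vert_proj, edgePt_zero]
      · rw [h1, L.vert_proj, edgePt_one]
      · rw [(L.edge e).proj, L.edge_base]

/-- The edge loop `P` at the root represents `w`: the lift of `P` that starts at the chosen lift
`x₀` of the root ends at `w x₀`. -/
def Represents (P : List (E × Bool)) (w : Deck p) : Prop :=
  ∃ Q : List (Γ.CoverEdge p × Bool),
    (Γ.coverGraph p).IsWalk (L.vert L.root) Q (moveVertex w (L.vert L.root)) ∧
    Q.map (fun s => (s.1.base, s.2)) = P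

/-- The edge `e` belongs to `w`: every cyclic reduction of `w` uses `e` or its reverse. -/
def Belongs (e : E) (w : Deck p) : Prop :=
  ∀ P, L.Represents P w → ∀ C, IsCyclicReduction P C → Uses C e

end CoherentLabeling

end Cover

/-! ### Rotation elements -/

/-- The identification of formal rational powers: `(w ^ k) ^ q = w ^ (k * q)` for an integer `k`
and a rational `q`. -/
inductive PowRel (π : Type*) [Group π] : π × ℚ → π × ℚ → Prop
  | pow (w : π) (k : ℤ) (q : ℚ) : PowRel π (w ^ k, q) (w, k * q)

/-- Formal rational powers of elements of a group. -/
def RatPow (π : Type*) [Group π] : Type _ := Quot (PowRel π)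

/-- The formal rational power `w ^ q`. -/
def ratPow {π : Type*} [Group π] (w : π) (q : ℚ) : RatPow π := Quot.mk _ (w, q)

/-- The point `x` is periodic under `f`, and its rotation element with respect to the lift `F` is
`ρ`: for some `n ≥ 1` we have `f^n x = x`, and `F^n` maps the chosen lift of `x` to its image under
`w`, where `ρ = w ^ (1 / n)`. -/
def CoherentLabeling.IsPeriodicWithRotation {V E X : Type*} [TopologicalSpace X]
    {Γ : Multigraph V E} {p : X → Γ.Space} (L : Γ.CoherentLabeling p)
    (f : C(Γ.Space, Γ.Space)) (F : C(X, X)) (x : Γ.Space) (ρ : RatPow (Deck p)) : Prop :=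
  ∃ n : ℕ, 0 < n ∧ f^[n] x = x ∧
    ∃ w : Deck p, F^[n] (L.lift x) = w.1 (L.lift x) ∧ ρ = ratPow w (1 / (n : ℚ))

end Multigraph

/-!
The lift `F` is studied on the chosen lift `c` of the edge `e`, from `c 0` to `c 1`. The universal
covering is a tree, so the interior of `c` separates it. The separation is carried by a continuous
height function `h` with `h (c t) = t` whose values lie outside `(0, 1)` off the interior of `c`
(`IsHeight`, `exists_isHeight`): collapsing the complement of the interior of `c` to a point gives a
map to the circle, and `h` is a lift of it to the line. The two sides of `c` are `{h ≤ 0}` and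
`{1 ≤ h}`.

The hypothesis on `P₁` and `P₂` says that `w₁` carries `c 0` beyond `c 1` and that `w₂` carries
`c 1` beyond `c 0`. The same holds for all their positive powers (`side_pow_iff`): edge paths in
the covering with a given start correspond to words in the edges of the graph, a reduced path never
returns to its first edge (`first_edge_not_mem`), and a power of a reduced word `A C A⁻¹`, with `C`
cyclically reduced, reduces to `A Cⁿ A⁻¹` and so begins with the same letter.

Put `G = F ^ (m n)`, `u = w₁ ^ n` and `v = w₂ ^ m`, so that `G (c 0) = u (c 0)` and
`G (c 1) = v (c 1)`. For `j < k` one needs a point of `c` with `G ^ (2 k) x = u ^ (2 j) x`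
(`IsHeight.exists_periodic`). Since `u` acts freely, the translates of `c` by `u` and `u⁻¹` avoid
the interior of `c`, and each of them lies on one side. The translate by `u` lies beyond `c 1`.

* If the translate by `u⁻¹` lies on the side of `c 0`, then `c` is on the axis of `u` and `u⁻¹` maps
  the side of `c 0` into itself. The map `u ^ (-2 j) ∘ G ^ (2 k)` then takes `c 0` beyond `c 1` and
  `c 1` beyond `c 0`, and the intermediate value theorem gives a fixed point in the interior of `c`.
* Otherwise `c` is off the axis, and both `u` and `u⁻¹` map the side of `c 0` beyond `c 1`. Then the
  image of `c` under `G` crosses first the translate of `c` by `u` and later `c` itself. This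
  horseshoe contains periodic orbits with every itinerary
  (`IsHeight.exists_periodic_of_horseshoe`).

The statement for `w₂` follows by reversing `c` (`IsHeight.symm`).
-/

namespace Multigraph

/-! ### Periodic points forced by an arc that separates -/

section Arc

variable {X : Type*} [TopologicalSpace X]

/-- `h` is a height function for the arc `c`: it restricts to the parameter on `c`, and only points
of `c` have a height strictly between `0` and `1`. The end points of `c` are then separated by its
interior: the two sides are `{h ≤ 0}` and `{1 ≤ h}`. -/
structure IsHeight (c : C(I, X)) (h : C(X, ℝ)) : Prop where
  on_arc : ∀ t, h (c t) = t
  mem_arc : ∀ x, 0 < h x → h x < 1 → ∃ t, x = c t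

namespace IsHeight

variable {c : C(I, X)} {h : C(X, ℝ)} (H : IsHeight c h)
include H

theorem eq_arc {x : X} {t : I} (hx : h x = t) (h0 : 0 < h x) (h1 : h x < 1) : x = c t := by
  obtain ⟨s, rfl⟩ := H.mem_arc x h0 h1
  rw [H.on_arc] at hx
  rw [Subtype.ext hx]

/-- The arc run backwards, with the two sides exchanged. -/
theorem symm : IsHeight (c.comp ⟨σ, unitInterval.continuous_symm⟩) (1 - h) where
  on_arc t := by simp [H.on_arc]
  mem_arc x h0 h1 := by
    obtain ⟨t, rfl⟩ := H.mem_arc x (by simpa using h1) (by simpa using h0)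
    exact ⟨σ t, by simp⟩

/-- The side `{h ≤ a}` is the image of the whole space under the retraction that sends everything
on the other side to `c a`. -/
theorem isPreconnected_le [PreconnectedSpace X] {a : I} (h0 : 0 < (a : ℝ)) (h1 : (a : ℝ) < 1) :
    IsPreconnected {x | h x ≤ a} := by
  classical
  have hR : Continuous fun x => if h x ≤ a then x else c a :=
    Continuous.if_le continuous_id continuous_const h.continuous continuous_const
      fun x hx => H.eq_arc hx (hx ▸ h0) (hx ▸ h1)
  have : {x | h x ≤ a} = Set.range fun x => if h x ≤ a then x else c a := by
    ext x
    refine ⟨fun hx => ⟨x, if_pos hx⟩, ?_⟩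
    rintro ⟨y, rfl⟩
    by_cases hy : h y ≤ a
    · simp [hy]
    · simp [hy, H.on_arc]
  rw [this]
  exact isPreconnected_range hR

omit H in
/-- A connected set that avoids the interior of the arc lies on one side. -/
theorem one_le_of_isPreconnected {S : Set X} (hS : IsPreconnected S)
    (hav : ∀ x ∈ S, ¬ (0 < h x ∧ h x < 1)) {x y : X} (hx : x ∈ S) (hy : y ∈ S) (h1 : 1 ≤ h x) :
    1 ≤ h y := by
  by_contra hlt
  have hy0 : h y ≤ 0 := by
    by_contra h0
    exact hav y hy ⟨not_le.1 h0, not_le.1 hlt⟩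
  obtain ⟨z, hz, hz'⟩ := hS.intermediate_value hy hx h.continuous.continuousOn
    (show (1 / 2 : ℝ) ∈ Set.Icc (h y) (h x) from ⟨by linarith, by linarith⟩)
  exact hav z hz ⟨by rw [hz']; norm_num, by rw [hz']; norm_num⟩

omit H in
/-- A translate of the arc that avoids its interior lies on one side. -/
theorem arc_side {u : X → X} (hu : Continuous u)
    (hav : ∀ s, ¬ (0 < h (u (c s)) ∧ h (u (c s)) < 1)) :
    (∀ s, h (u (c s)) ≤ 0) ∨ ∀ s, 1 ≤ h (u (c s)) := by
  by_cases h1 : ∃ s, 1 ≤ h (u (c s))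
  · obtain ⟨s, hs⟩ := h1
    refine Or.inr fun t => ?_
    refine one_le_of_isPreconnected (S := Set.range fun s => u (c s))
      (isPreconnected_range (hu.comp c.continuous)) ?_ ⟨s, rfl⟩ ⟨t, rfl⟩ hs
    rintro _ ⟨s, rfl⟩
    exact hav s
  · push Not at h1
    exact Or.inl fun s => not_lt.1 fun h0 => hav s ⟨h0, h1 s⟩

/-- If the preimage of the arc under a homeomorphism `u` lies beyond `c 1`, then `u` maps the side
of `c 0` into a single side. -/
theorem side_map [PreconnectedSpace X] (u : X ≃ₜ X) (hinv : ∀ s, 1 ≤ h (u.symm (c s)))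
    {x : X} (hx : h x < 1) : ¬ (0 < h (u x) ∧ h (u x) < 1) ∧ (1 ≤ h (u x) ↔ 1 ≤ h (u (c 0))) := by
  obtain ⟨a, ha, ha1⟩ := exists_between (max_lt hx zero_lt_one)
  have ha0 := (le_max_right _ _).trans_lt ha
  lift a to I using ⟨ha0.le, ha1.le⟩
  have hS := (H.isPreconnected_le ha0 ha1).image u u.continuous.continuousOn
  have hav : ∀ y ∈ u '' {x | h x ≤ a}, ¬ (0 < h y ∧ h y < 1) := by
    rintro _ ⟨z, hz, rfl⟩ ⟨h0, h1⟩
    obtain ⟨s, hs⟩ := H.mem_arc _ h0 h1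
    have := hinv s
    rw [← hs, Homeomorph.symm_apply_apply] at this
    exact absurd (this.trans hz) (not_le.2 ha1)
  have hxS : u x ∈ u '' {x | h x ≤ a} := ⟨x, ((le_max_left _ _).trans_lt ha).le, rfl⟩
  have h0S : u (c 0) ∈ u '' {x | h x ≤ a} := ⟨c 0, by simp [H.on_arc, ha0.le], rfl⟩
  exact ⟨hav _ hxS, one_le_of_isPreconnected hS hav hxS h0S,
    one_le_of_isPreconnected hS hav h0S hxS⟩

/-- A map that exchanges the sides of the two end points fixes an interior point of the arc. -/
theorem exists_fixed {g : X → X} (hg : Continuous g) (h0 : 1 ≤ h (g (c 0)))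
    (h1 : h (g (c 1)) ≤ 0) : ∃ t : I, 0 < t ∧ t < 1 ∧ g (c t) = c t := by
  have hcont : Continuous fun t : I => h (g (c t)) - t := by fun_prop
  obtain ⟨t, ht⟩ := mem_range_of_exists_le_of_exists_ge (c := (0 : ℝ)) hcont
    ⟨1, by simp only [Set.Icc.coe_one]; linarith⟩ ⟨0, by simp only [Set.Icc.coe_zero]; linarith⟩
  have ht' : h (g (c t)) = t := sub_eq_zero.1 ht
  have ht0 : t ≠ 0 := by rintro rfl; simp only [Set.Icc.coe_zero] at ht'; linarith
  have ht1 : t ≠ 1 := by rintro rfl; simp only [Set.Icc.coe_one] at ht'; linarith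
  have hpos := unitInterval.pos_iff_ne_zero.2 ht0
  have hlt := unitInterval.lt_one_iff_ne_one.2 ht1
  refine ⟨t, hpos, hlt, H.eq_arc ht' ?_ ?_⟩
  · rw [ht']; exact hpos
  · rw [ht']; exact hlt

omit H in
/-- The map of the arc to itself obtained from `g` by projecting back to the arc along `h`. -/
noncomputable def arcMap (c : C(I, X)) (h : C(X, ℝ)) (g : C(X, X)) : C(I, I) where
  toFun t := Set.projIcc 0 1 zero_le_one (h (g (c t)))

omit H in
theorem arcMap_eq_zero {g : C(X, X)} {t : I} (ht : h (g (c t)) ≤ 0) : arcMap c h g t = 0 :=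
  Set.projIcc_of_le_left zero_le_one ht

omit H in
theorem arcMap_eq_one {g : C(X, X)} {t : I} (ht : 1 ≤ h (g (c t))) : arcMap c h g t = 1 :=
  Set.projIcc_of_right_le zero_le_one ht

theorem apply_eq_of_arcMap {g : C(X, X)} {t : I} (h0 : arcMap c h g t ≠ 0)
    (h1 : arcMap c h g t ≠ 1) : g (c t) = c (arcMap c h g t) := by
  have h0' : 0 < h (g (c t)) := not_le.1 fun h' => h0 (arcMap_eq_zero h')
  have h1' : h (g (c t)) < 1 := not_le.1 fun h' => h1 (arcMap_eq_one h')
  refine H.eq_arc ?_ h0' h1'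
  simp only [arcMap, ContinuousMap.coe_mk]
  rw [Set.projIcc_of_mem zero_le_one ⟨h0'.le, h1'.le⟩]

/-- If the projected map permutes the end points, then an orbit of it that ends in the interior of
the arc is an orbit of `g`. -/
theorem iterate_eq_of_arcMap {g : C(X, X)} (hends : ∀ t, t = 0 ∨ t = 1 →
    arcMap c h g t = 0 ∨ arcMap c h g t = 1) {N : ℕ} {t : I}
    (hN : ¬ ((arcMap c h g)^[N] t = 0 ∨ (arcMap c h g)^[N] t = 1)) :
    ¬ (t = 0 ∨ t = 1) ∧ g^[N] (c t) = c ((arcMap c h g)^[N] t) := by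
  induction N with
  | zero => exact ⟨hN, rfl⟩
  | succ N ih =>
    rw [Function.iterate_succ_apply'] at hN
    obtain ⟨ht, hg⟩ := ih fun h' => hN (hends _ h')
    rw [Function.iterate_succ_apply', Function.iterate_succ_apply', hg]
    push Not at hN
    exact ⟨ht, H.apply_eq_of_arcMap hN.1 hN.2⟩

/-- The case in which `u` moves the arc off itself and each of `u`, `u⁻¹` maps the side of `c 0`
beyond `c 1`. Then `G` maps the arc across its translate by `u` and back across itself. This
horseshoe has an orbit that follows every itinerary; here it makes `2 l` turns across the arc and
`J` turns across the translate. -/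
theorem exists_periodic_of_horseshoe [PreconnectedSpace X] (G : C(X, X)) (u : X ≃ₜ X)
    (hGu : ∀ x, G (u x) = u (G x)) (hu0 : G (c 0) = u (c 0)) (h1 : h (G (c 1)) ≤ 0)
    (hα : 1 ≤ h (u (c 0))) (hβ : ∀ x, h x < 1 → 1 ≤ h (u.symm x)) (l J : ℕ) (hl : 0 < l) :
    ∃ t : I, 0 < t ∧ t < 1 ∧ G^[2 * l + J] (c t) = u^[J] (c t) := by
  have hcomm : ∀ x, G (u.symm x) = u.symm (G x) := fun x => by
    rw [Homeomorph.eq_symm_apply, ← hGu, Homeomorph.apply_symm_apply]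
  let G' : C(X, X) := (u.symm : C(X, X)).comp G
  have hG' : ∀ x, G' x = u.symm (G x) := fun _ => rfl
  set ψ := arcMap c h G
  set φ := arcMap c h G'
  have ψ0 : ψ 0 = 1 := arcMap_eq_one (by rwa [hu0])
  have ψ1 : ψ 1 = 0 := arcMap_eq_zero h1
  have φ0 : φ 0 = 0 := arcMap_eq_zero (by simp [hG', hu0, H.on_arc])
  have φ1 : φ 1 = 1 := arcMap_eq_one (hβ _ (h1.trans_lt one_pos))
  have ψψ0 : ∀ n : ℕ, ψ^[2 * n] 0 = 0 := fun n => by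
    rw [Function.iterate_mul]
    exact Function.iterate_fixed (by simp [ψ0, ψ1]) n
  have ψψ1 : ∀ n : ℕ, ψ^[2 * n] 1 = 1 := fun n => by
    rw [Function.iterate_mul]
    exact Function.iterate_fixed (by simp [ψ0, ψ1]) n
  obtain ⟨l, rfl⟩ : ∃ l', l = l' + 1 := ⟨l - 1, by omega⟩
  -- Near `c 0` the image under `G` is still beyond `c 1`, on its way to the translate of the arc.
  obtain ⟨b, hb0, hb1, hψb⟩ : ∃ b : I, 0 < b ∧ b < 1 ∧ ψ b = 1 := by
    have hev : ∀ᶠ t in nhds (0 : I), h (G' (c t)) < 1 := by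
      refine ContinuousAt.eventually_lt (by fun_prop) continuousAt_const ?_
      simp [hG', hu0, H.on_arc]
    have hne : (nhdsWithin (0 : I) (Set.Ioo 0 1)).NeBot := by
      rw [← mem_closure_iff_nhdsWithin_neBot, closure_Ioo zero_ne_one]
      exact ⟨le_rfl, zero_le_one⟩
    obtain ⟨b, hb, hbI⟩ := ((hev.filter_mono nhdsWithin_le_nhds).and
      self_mem_nhdsWithin : ∀ᶠ t in nhdsWithin (0 : I) (Set.Ioo 0 1), _ ∧ _).exists
    refine ⟨b, hbI.1, hbI.2, arcMap_eq_one ?_⟩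
    by_contra hlt
    exact absurd (hβ _ (not_le.1 hlt)) (not_le.2 hb)
  obtain ⟨d, hd, hψd⟩ := intermediate_value_Icc' hb1.le ψ.continuous.continuousOn
    (show b ∈ Set.Icc (ψ 1) (ψ b) by rw [ψ1, hψb]; exact ⟨hb0.le, hb1.le⟩)
  have hd1 : d < 1 := lt_of_le_of_ne hd.2 (by rintro rfl; exact hb0.ne (ψ1.symm.trans hψd))
  -- Since `ψ` exchanges the end points, `ψ^[2]` maps `[b, d]` onto the arc, and so does `Ψ`. Its
  -- fixed point there is interior, and its orbit avoids the end points, which `ψ` and `φ` permute.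
  let Ψ : I → I := fun t => φ^[J] (ψ^[2 * (l + 1)] t)
  have hΨ : Continuous Ψ :=
    (φ.continuous.iterate J).comp (ψ.continuous.iterate _)
  have hΨb : Ψ b = 0 := by
    show φ^[J] (ψ^[2 * l + 1 + 1] b) = 0
    rw [Function.iterate_succ_apply, Function.iterate_succ_apply, hψb, ψ1, ψψ0,
      Function.iterate_fixed φ0]
  have hΨd : Ψ d = 1 := by
    show φ^[J] (ψ^[2 * l + 1 + 1] d) = 1
    rw [Function.iterate_succ_apply, Function.iterate_succ_apply, hψd, hψb, ψψ1,
      Function.iterate_fixed φ1]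
  obtain ⟨t, ht, hfix⟩ : ∃ t ∈ Set.Icc b d, (Ψ t : ℝ) - t = 0 := by
    have hc : Continuous fun t : I => (Ψ t : ℝ) - t := by fun_prop
    refine intermediate_value_Icc hd.1 hc.continuousOn ⟨?_, ?_⟩
    · rw [hΨb]; simpa using b.2.1
    · rw [hΨd]; simpa using d.2.2
  replace hfix : φ^[J] (ψ^[2 * (l + 1)] t) = t := Subtype.ext (sub_eq_zero.1 hfix)
  have ht0 : 0 < t := hb0.trans_le ht.1
  have ht1 : t < 1 := ht.2.trans_lt hd1
  have hφ := H.iterate_eq_of_arcMap (g := G') (N := J) (t := ψ^[2 * (l + 1)] t)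
    (by rintro t (rfl | rfl); exacts [Or.inl φ0, Or.inr φ1])
    (by rw [hfix]; rintro (h' | h'); exacts [ht0.ne' h', ht1.ne h'])
  have hψ := H.iterate_eq_of_arcMap (g := G) (N := 2 * (l + 1)) (t := t)
    (by rintro t (rfl | rfl); exacts [Or.inr ψ0, Or.inl ψ1]) hφ.1
  refine ⟨t, ht0, ht1, ?_⟩
  have hG'G : ∀ x, G'^[J] x = u.symm^[J] (G^[J] x) := fun x =>
    Function.Commute.comp_iterate (f := u.symm) (g := G) (fun x => (hcomm x).symm) J ▸ rfl
  have hinv : ∀ x, u^[J] (u.symm^[J] x) = x :=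
    Function.RightInverse.iterate (u.apply_symm_apply) J
  rw [add_comm, Function.iterate_add_apply, hψ.2, ← hinv (G^[J] _), ← hG'G, hφ.2, hfix]

/-- Suppose that `u` and its inverse move the arc `c` off its own interior, that `G` moves `c 0` as
`u` does and `c 1` as `v` does, that positive powers of `u` carry `c 0` beyond `c 1`, and that
positive powers of `v` carry `c 1` beyond `c 0`. Then every rotation `u ^ (j / k)` with `j < k` is
realized by `G` in the interior of the arc. Either `u⁻¹` maps the side of `c 0` into itself, and
`u ^ (-2 j) ∘ G ^ (2 k)` exchanges the sides of the end points; or there is a horseshoe. -/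
theorem exists_periodic [PreconnectedSpace X] (G : C(X, X)) (u v : X ≃ₜ X)
    (hGu : ∀ x, G (u x) = u (G x)) (hGv : ∀ x, G (v x) = v (G x))
    (hu0 : G (c 0) = u (c 0)) (hv1 : G (c 1) = v (c 1))
    (hav : ∀ s t, 0 < t → t < 1 → u (c s) ≠ c t)
    (hav' : ∀ s t, 0 < t → t < 1 → u.symm (c s) ≠ c t)
    (hup : ∀ k, 0 < k → 1 ≤ h (u^[k] (c 0))) (hvp : ∀ k, 0 < k → h (v^[k] (c 1)) ≤ 0)
    (j k : ℕ) (hjk : j < k) :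
    ∃ t : I, 0 < t ∧ t < 1 ∧ G^[2 * k] (c t) = u^[2 * j] (c t) := by
  have hoff : ∀ w : X → X, (∀ s t, 0 < t → t < 1 → w (c s) ≠ c t) →
      ∀ s, ¬ (0 < h (w (c s)) ∧ h (w (c s)) < 1) := by
    rintro w hw s ⟨h0, h1⟩
    obtain ⟨t, ht⟩ := H.mem_arc _ h0 h1
    rw [ht, H.on_arc] at h0 h1
    exact hw s t h0 h1 ht
  have hα0 : 1 ≤ h (u (c 0)) := hup 1 one_pos
  have hα : ∀ s, 1 ≤ h (u (c s)) := by
    refine (arc_side u.continuous (hoff _ hav)).resolve_left fun h' => ?_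
    linarith [h' 0]
  rcases arc_side u.symm.continuous (hoff _ hav') with hβ | hβ
  · have hmaps : ∀ x, h x ≤ 0 → h (u.symm x) ≤ 0 := fun x hx => by
      obtain ⟨h1, h2⟩ := H.side_map u.symm hα (hx.trans_lt one_pos)
      by_contra h0
      have := h2.1 (not_lt.1 fun h' => h1 ⟨not_le.1 h0, h'⟩)
      linarith [hβ 0]
    have hmaps' : ∀ i x, h x ≤ 0 → h (u.symm^[i] x) ≤ 0 := fun i => by
      induction i with
      | zero => exact fun x hx => hx
      | succ i ih => exact fun x hx => ih _ (hmaps _ hx)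
    have hGi : ∀ (w : X ≃ₜ X) (x : X), (∀ y, G (w y) = w (G y)) → G x = w x →
        ∀ i, G^[i] x = w^[i] x := fun w x hw hx i => by
      induction i with
      | zero => rfl
      | succ i ih =>
        rw [Function.iterate_succ_apply', ih, Function.iterate_succ_apply, ← hx]
        exact (Function.Commute.iterate_right (f := G) (g := w) hw i) x
    obtain ⟨t, ht0, ht1, ht⟩ := H.exists_fixed (g := fun x => u.symm^[2 * j] (G^[2 * k] x))
      ((u.symm.continuous.iterate _).comp (G.continuous.iterate _))
      (by
        obtain ⟨i, rfl⟩ : ∃ i, k = j + (i + 1) := ⟨k - j - 1, by omega⟩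
        rw [hGi u _ hGu hu0, mul_add, Function.iterate_add_apply,
          Function.LeftInverse.iterate u.symm_apply_apply]
        exact hup _ (by omega))
      (by
        rw [hGi v _ hGv hv1]
        exact hmaps' _ _ (hvp _ (by omega)))
    refine ⟨t, ht0, ht1, ?_⟩
    conv_rhs => rw [← ht]
    rw [Function.RightInverse.iterate u.apply_symm_apply]
  · have hmaps : ∀ x, h x < 1 → 1 ≤ h (u.symm x) := fun x hx =>
      (H.side_map u.symm hα hx).2.2 (hβ 0)
    obtain ⟨t, ht⟩ := H.exists_periodic_of_horseshoe G u hGu hu0 (hv1 ▸ hvp 1 one_pos) hα0 hmaps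
      (k - j) (2 * j) (by omega)
    rw [show 2 * (k - j) + 2 * j = 2 * k by omega] at ht
    exact ⟨t, ht⟩

end IsHeight

end Arc

/-! ### The circle coordinate of an edge -/

section Coordinate

variable {V E : Type*} (Γ : Multigraph V E)

theorem continuous_edgePt (e : E) : Continuous (Γ.edgePt e) := by
  let : TopologicalSpace V := ⊥
  exact continuous_quot_mk.comp (continuous_inr.comp continuous_sigmaMk)

instance : LocallyPathConnectedSpace Γ.Space := by
  let : TopologicalSpace V := ⊥
  have : DiscreteTopology V := ⟨rfl⟩
  have : LocallyPathConnectedSpace I :=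
    (isQuotientMap_projIcc (h := zero_le_one' ℝ)).locallyPathConnectedSpace
  exact inferInstanceAs (LocallyPathConnectedSpace (Quot Γ.Glue))

open Classical in
/-- The map to the circle `ℝ / ℤ` that winds the edge `e` once around the circle and collapses the
rest of the graph to the point `0`. -/
noncomputable def edgeCoord (e : E) : C(Γ.Space, UnitAddCircle) where
  toFun := Quot.lift
    (fun a => match a with
      | Sum.inl _ => 0
      | Sum.inr ⟨e', t⟩ => if e' = e then ((t : ℝ) : UnitAddCircle) else 0)
    (by
      intro a b h
      cases h with
      | src e => simp
      | tgt e => simp [AddCircle.coe_period])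
  continuous_toFun := by
    let : TopologicalSpace V := ⊥
    have : DiscreteTopology V := ⟨rfl⟩
    refine continuous_quot_lift _ ?_
    refine continuous_sum_dom.2 ⟨continuous_of_discreteTopology, continuous_sigma fun e' => ?_⟩
    by_cases h : e' = e
    · simp only [Function.comp_def, h, if_true]
      exact (AddCircle.continuous_mk' 1).comp continuous_subtype_val
    · simp only [Function.comp_def, h, if_false]
      exact continuous_const

theorem edgeCoord_edgePt (e : E) (t : I) :
    Γ.edgeCoord e (Γ.edgePt e t) = ((t : ℝ) : UnitAddCircle) :=
  if_pos rfl

theorem coe_ne_zero_of_mem_Ioo {t : I} (h0 : 0 < t) (h1 : t < 1) :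
    ((t : ℝ) : UnitAddCircle) ≠ 0 := by
  intro h
  obtain ⟨n, hn⟩ := (AddCircle.coe_eq_zero_iff (1 : ℝ)).1 h
  rw [zsmul_eq_mul, mul_one] at hn
  have h0' : (0 : ℝ) < n := hn ▸ h0
  have h1' : (n : ℝ) < 1 := hn ▸ h1
  norm_cast at h0' h1'
  omega

/-- Only interior points of the edge have a nonzero circle coordinate. -/
theorem eq_edgePt_of_edgeCoord_ne_zero {e : E} {x : Γ.Space} (hx : Γ.edgeCoord e x ≠ 0) :
    ∃ t : I, 0 < t ∧ t < 1 ∧ x = Γ.edgePt e t := by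
  induction x using Quot.ind with
  | mk a =>
    rcases a with v | ⟨e', t⟩
    · exact absurd rfl hx
    · have he : e' = e := by
        by_contra h
        exact hx (if_neg h)
      subst he
      change Γ.edgeCoord e' (Γ.edgePt e' t) ≠ 0 at hx
      rw [edgeCoord_edgePt] at hx
      refine ⟨t, unitInterval.pos_iff_ne_zero.2 ?_, unitInterval.lt_one_iff_ne_one.2 ?_, rfl⟩
      · rintro rfl; exact hx (by simp)
      · rintro rfl; exact hx (AddCircle.coe_period 1)

theorem coe_injOn_Ioo {s t : I} (hs0 : 0 < s) (hs1 : s < 1) (ht0 : 0 ≤ t) (ht1 : t ≤ 1)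
    (h : ((s : ℝ) : UnitAddCircle) = ((t : ℝ) : UnitAddCircle)) : s = t := by
  rw [AddCircle.coe_eq_coe_iff_of_mem_Ico (a := 0) (p := (1 : ℝ))] at h
  · exact Subtype.ext h
  · exact ⟨hs0.le, by simpa using hs1⟩
  · refine ⟨ht0, ?_⟩
    rw [zero_add]
    refine lt_of_le_of_ne ht1 fun h1 => coe_ne_zero_of_mem_Ioo hs0 hs1 ?_
    rw [h, h1]
    exact AddCircle.coe_period 1

/-- Interior points of edges are not identified with any other point. -/
theorem edgePt_inj_of_mem_Ioo {e e' : E} {s t : I} (hs0 : 0 < s) (hs1 : s < 1)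
    (h : Γ.edgePt e s = Γ.edgePt e' t) : e = e' ∧ s = t := by
  have hcoord := Γ.edgeCoord_edgePt e s
  rw [h] at hcoord
  by_cases he : e' = e
  · subst he
    rw [edgeCoord_edgePt] at hcoord
    exact ⟨rfl, coe_injOn_Ioo hs0 hs1 t.2.1 t.2.2 hcoord.symm⟩
  · exact absurd (hcoord.symm.trans (if_neg he)) (coe_ne_zero_of_mem_Ioo hs0 hs1)

theorem isOpenEmbedding_edgePt (e : E) :
    Topology.IsOpenEmbedding fun t : Set.Ioo (0 : I) 1 => Γ.edgePt e t := by
  refine .of_continuous_injective_isOpenMap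
    ((Γ.continuous_edgePt e).comp continuous_subtype_val)
    (fun s t h => Subtype.ext (Γ.edgePt_inj_of_mem_Ioo s.2.1 s.2.2 h).2) fun U hU => ?_
  -- The image of `U` is the preimage under the circle coordinate of its image in the circle.
  have hop : IsOpen ((fun t : ℝ => (t : UnitAddCircle)) ''
      (((↑) : I → ℝ) '' (((↑) : Set.Ioo (0 : I) 1 → I) '' U))) := by
    refine QuotientAddGroup.isOpenMap_coe _ ?_
    have hU' := isOpen_Ioo.isOpenMap_subtype_val _ hU
    obtain ⟨W, hW, hWU⟩ := isOpen_induced_iff.1 hU'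
    have : ((↑) : I → ℝ) '' (((↑) : Set.Ioo (0 : I) 1 → I) '' U) = W ∩ Set.Ioo 0 1 := by
      rw [← hWU]
      ext x
      constructor
      · rintro ⟨t, ht, rfl⟩
        refine ⟨ht, ?_⟩
        rw [hWU] at ht
        obtain ⟨s, -, rfl⟩ := ht
        exact s.2
      · rintro ⟨hx, hx'⟩
        exact ⟨⟨x, hx'.1.le, hx'.2.le⟩, hx, rfl⟩
    rw [this]
    exact hW.inter isOpen_Ioo
  convert hop.preimage (Γ.edgeCoord e).continuous using 1
  ext x
  constructor
  · rintro ⟨t, ht, rfl⟩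
    exact ⟨t, ⟨t, ⟨t, ht, rfl⟩, rfl⟩, (Γ.edgeCoord_edgePt e t).symm⟩
  · rintro ⟨_, ⟨_, ⟨s, hs, rfl⟩, rfl⟩, hx⟩
    have hne : Γ.edgeCoord e x ≠ 0 := hx ▸ coe_ne_zero_of_mem_Ioo s.2.1 s.2.2
    obtain ⟨t, ht0, ht1, rfl⟩ := Γ.eq_edgePt_of_edgeCoord_ne_zero hne
    rw [edgeCoord_edgePt] at hx
    exact ⟨s, hs, congrArg (Γ.edgePt e) (coe_injOn_Ioo s.2.1 s.2.2 t.2.1 t.2.2 hx)⟩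

end Coordinate

/-! ### Lifted edges and their height functions -/

theorem _root_.IsLocalHomeomorph.locallyPathConnectedSpace {X Y : Type*} [TopologicalSpace X]
    [TopologicalSpace Y] [LocallyPathConnectedSpace Y] {p : X → Y} (hp : IsLocalHomeomorph p) :
    LocallyPathConnectedSpace X := by
  choose φ hφ _ using hp
  let _ : ChartedSpace Y X :=
    { atlas := Set.range φ
      chartAt := φ
      mem_chart_source := hφ
      chart_mem_atlas := fun x => ⟨x, rfl⟩ }
  exact ChartedSpace.locallyPathConnectedSpace Y X

section Lifts

variable {V E X : Type*} [TopologicalSpace X] {Γ : Multigraph V E} {p : X → Γ.Space}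
  (hp : IsCoveringMap p)
include hp

/-- Lifted edges over the same edge that share a point with the same parameter coincide. -/
theorem coverEdge_ext {c d : Γ.CoverEdge p} (hb : c.base = d.base) {t : I}
    (h : c.path t = d.path t) : c = d := by
  obtain ⟨e, γ, hγ⟩ := c
  obtain ⟨e', δ, hδ⟩ := d
  obtain rfl : e = e' := hb
  have : (γ : I → X) = δ := hp.eq_of_comp_eq γ.continuous δ.continuous
    (funext fun s => (hγ s).trans (hδ s).symm) t h
  rw [CoverEdge.mk.injEq]
  exact ⟨rfl, DFunLike.coe_injective this⟩

/-- Lifted edges that meet in an interior point coincide. -/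
theorem coverEdge_ext_of_mem {c d : Γ.CoverEdge p} {s t : I} (h0 : 0 < s)
    (h1 : s < 1) (h : c.path s = d.path t) : c = d ∧ s = t := by
  obtain ⟨hb, rfl⟩ := Γ.edgePt_inj_of_mem_Ioo (e := c.base) (e' := d.base) h0 h1
    (by rw [← c.proj, h, d.proj])
  exact ⟨coverEdge_ext hp hb h, rfl⟩

theorem exists_coverEdge {e : E} {t : I} {x : X} (hx : p x = Γ.edgePt e t) :
    ∃ c : Γ.CoverEdge p, c.base = e ∧ c.path t = x := by
  have : LocallyPathConnectedSpace I :=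
    (isQuotientMap_projIcc (h := zero_le_one' ℝ)).locallyPathConnectedSpace
  have : ContractibleSpace I :=
    (convex_Icc (0 : ℝ) 1).contractibleSpace ⟨0, Set.left_mem_Icc.2 zero_le_one⟩
  obtain ⟨γ, ⟨h1, h2⟩, -⟩ := hp.existsUnique_continuousMap_lifts
    ⟨Γ.edgePt e, Γ.continuous_edgePt e⟩ t x hx
  exact ⟨⟨e, γ, congrFun h2⟩, rfl, h1⟩

theorem isOpen_interior (c : Γ.CoverEdge p) : IsOpen (c.path '' Set.Ioo 0 1) := by
  have hemb : Topology.IsOpenEmbedding fun t : Set.Ioo (0 : I) 1 => c.path t := by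
    refine hp.isLocalHomeomorph.isOpenEmbedding_of_comp ?_
      (c.path.continuous.comp continuous_subtype_val)
    convert Γ.isOpenEmbedding_edgePt c.base using 1
    funext t
    exact c.proj t
  convert hemb.isOpen_range using 1
  ext x
  simp

open Classical in
/-- Collapsing the complement of the lifted edge `c` to a point gives a continuous map to the
circle. -/
theorem continuous_collapse (c : Γ.CoverEdge p) : Continuous fun x =>
    if x ∈ c.path '' Set.Ioo 0 1 then Γ.edgeCoord c.base (p x) else 0 := by
  have hcont : Continuous fun x => Γ.edgeCoord c.base (p x) :=
    (Γ.edgeCoord c.base).continuous.comp hp.continuous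
  rw [continuous_iff_continuousAt]
  intro x
  by_cases hx : Γ.edgeCoord c.base (p x) = 0
  · have h0 : (if x ∈ c.path '' Set.Ioo 0 1 then Γ.edgeCoord c.base (p x) else 0) = 0 := by
      simp [hx]
    rw [ContinuousAt, h0]
    refine squeeze_zero_norm (a := fun y => ‖Γ.edgeCoord c.base (p y)‖) (fun y => ?_) ?_
    · split_ifs <;> simp
    · have := hcont.norm.tendsto x
      rwa [hx, norm_zero] at this
  · -- `x` lies in the interior of a lift of the same edge, which is `c` or disjoint from `c`.
    obtain ⟨t, ht0, ht1, ht⟩ := Γ.eq_edgePt_of_edgeCoord_ne_zero hx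
    obtain ⟨d, hd, rfl⟩ := exists_coverEdge hp ht
    have hev : ∀ᶠ y in nhds (d.path t), y ∈ d.path '' Set.Ioo 0 1 :=
      (isOpen_interior hp d).mem_nhds ⟨t, ⟨ht0, ht1⟩, rfl⟩
    by_cases hdc : d = c
    · subst hdc
      refine hcont.continuousAt.congr (hev.mono fun y hy => ?_)
      exact (if_pos hy).symm
    · refine continuousAt_const.congr (f := fun _ => 0) (hev.mono fun y hy => ?_)
      refine (if_neg ?_).symm
      rintro ⟨s, hs, rfl⟩
      obtain ⟨r, hr, hrs⟩ := hy
      exact hdc (coverEdge_ext_of_mem hp hr.1 hr.2 hrs).1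

/-- Every lifted edge has a height function, since the map collapsing its complement to a point
lifts from the circle to the line. -/
theorem exists_isHeight [SimplyConnectedSpace X] (c : Γ.CoverEdge p) :
    ∃ h : C(X, ℝ), IsHeight c.path h := by
  classical
  have := hp.isLocalHomeomorph.locallyPathConnectedSpace
  have hc0 : c.path 0 ∉ c.path '' Set.Ioo 0 1 := by
    rintro ⟨s, hs, hs'⟩
    exact hs.1.ne' (coverEdge_ext_of_mem hp hs.1 hs.2 hs').2
  obtain ⟨h, ⟨h0, hlift⟩, -⟩ :=
    (AddCircle.isCoveringMap_coe (1 : ℝ)).existsUnique_continuousMap_lifts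
      ⟨_, continuous_collapse hp c⟩ (c.path 0) 0 (if_neg hc0).symm
  have hval : ∀ x, ((h x : ℝ) : UnitAddCircle) =
      if x ∈ c.path '' Set.Ioo 0 1 then Γ.edgeCoord c.base (p x) else 0 := congrFun hlift
  have hon : ∀ t, h (c.path t) = t := by
    refine congrFun ((AddCircle.isCoveringMap_coe (1 : ℝ)).eq_of_comp_eq
      (g₁ := fun t : I => h (c.path t)) (g₂ := fun t : I => (t : ℝ)) (by fun_prop) (by fun_prop)
      (funext fun t => ?_) 0 (by simpa using h0))
    change ((h (c.path t) : ℝ) : UnitAddCircle) = ((t : ℝ) : UnitAddCircle)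
    rw [hval, c.proj, edgeCoord_edgePt]
    split_ifs with hmem
    · rfl
    · have : t = 0 ∨ t = 1 := by
        by_contra hne
        push Not at hne
        exact hmem ⟨t, ⟨unitInterval.pos_iff_ne_zero.2 hne.1,
          unitInterval.lt_one_iff_ne_one.2 hne.2⟩, rfl⟩
      rcases this with rfl | rfl
      · simp
      · exact (AddCircle.coe_period 1).symm
  refine ⟨h, hon, fun x hx0 hx1 => ?_⟩
  have hne := coe_ne_zero_of_mem_Ioo (t := ⟨h x, hx0.le, hx1.le⟩) hx0 hx1
  rw [hval] at hne
  by_contra hmem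
  refine hne (if_neg ?_)
  rintro ⟨t, -, rfl⟩
  exact hmem ⟨t, rfl⟩

omit hp in
/-- The image of a lifted edge under a covering transformation. -/
def moveEdge (w : Deck p) (c : Γ.CoverEdge p) : Γ.CoverEdge p where
  base := c.base
  path := (w.1 : C(X, X)).comp c.path
  proj t := (w.2 _).trans (c.proj t)

theorem deck_eq_one [PreconnectedSpace X] (w : Deck p) {x : X} (hx : w.1 x = x) : w = 1 := by
  refine Subtype.ext (Homeomorph.ext (congrFun ?_))
  exact hp.eq_of_comp_eq w.1.continuous continuous_id (funext w.2) x hx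

/-- A nontrivial covering transformation moves a lifted edge off its interior. -/
theorem deck_path_ne [PreconnectedSpace X] {w : Deck p} (hw : w ≠ 1) (c : Γ.CoverEdge p)
    {s t : I} (h0 : 0 < t) (h1 : t < 1) : w.1 (c.path s) ≠ c.path t := by
  intro h
  obtain ⟨-, rfl⟩ := coverEdge_ext_of_mem hp (c := c) (d := moveEdge w c) h0 h1 h.symm
  exact hw (deck_eq_one hp w h)

end Lifts

/-! ### Edge paths in the universal covering -/

section Walks

variable {V E : Type*} (Γ : Multigraph V E)

theorem start_rev (s : E × Bool) : Γ.start (rev s) = Γ.finish s := by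
  rcases s with ⟨e, _ | _⟩ <;> rfl

theorem finish_rev (s : E × Bool) : Γ.finish (rev s) = Γ.start s := by
  rcases s with ⟨e, _ | _⟩ <;> rfl

theorem isWalk_append {u v : V} {P Q : List (E × Bool)} :
    Γ.IsWalk u (P ++ Q) v ↔ ∃ w, Γ.IsWalk u P w ∧ Γ.IsWalk w Q v := by
  induction P generalizing u with
  | nil => simp [IsWalk]
  | cons s P ih => simp [IsWalk, ih, and_assoc]

theorem IsWalk.cancel {u v : V} {P Q : List (E × Bool)} {s : E × Bool}
    (h : Γ.IsWalk u (P ++ s :: rev s :: Q) v) : Γ.IsWalk u (P ++ Q) v := by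
  obtain ⟨w, hP, hs, -, hQ⟩ := (Γ.isWalk_append).1 h
  rw [finish_rev, hs] at hQ
  exact (Γ.isWalk_append).2 ⟨w, hP, hQ⟩

theorem IsShortestWalk.reduced {u v : V} {P : List (E × Bool)} (h : Γ.IsShortestWalk u P v) :
    Reduced P := by
  refine List.isChain_iff_forall_rel_of_append_cons_cons.2 fun s t A B hP ht => ?_
  subst hP ht
  have := h.2 _ (IsWalk.cancel Γ h.1)
  simp at this

theorem exists_first_use {e : E} {P : List (E × Bool)} (h : ∃ s ∈ P, s.1 = e) :
    ∃ P₁ b P₂, P = P₁ ++ (e, b) :: P₂ ∧ ∀ s ∈ P₁, s.1 ≠ e := by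
  induction P with
  | nil => simp at h
  | cons s P ih =>
    by_cases hs : s.1 = e
    · exact ⟨[], s.2, P, by rw [← hs]; rfl, by simp⟩
    · obtain ⟨P₁, b, P₂, rfl, hP₁⟩ := ih (by simpa [hs] using h)
      exact ⟨s :: P₁, b, P₂, rfl, by simpa [hs] using hP₁⟩

end Walks

section Cover

variable {V E X : Type*} [TopologicalSpace X] {Γ : Multigraph V E} {p : X → Γ.Space}

/-- The word of an edge path in the covering: the edges of the graph over which it runs. -/
def word (Q : List (Γ.CoverEdge p × Bool)) : List (E × Bool) := Q.map fun s => (s.1.base, s.2)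

variable (p) in
/-- The edge path with word `P` that starts at `u` in the covering ends at `v`. -/
def HasLift (u : Γ.CoverVertex p) (P : List (E × Bool)) (v : Γ.CoverVertex p) : Prop :=
  ∃ Q, (Γ.coverGraph p).IsWalk u Q v ∧ word Q = P

theorem HasLift.append {u v w : Γ.CoverVertex p} {P Q : List (E × Bool)} (hP : HasLift p u P v)
    (hQ : HasLift p v Q w) : HasLift p u (P ++ Q) w := by
  obtain ⟨P', hP', rfl⟩ := hP
  obtain ⟨Q', hQ', rfl⟩ := hQ
  exact ⟨P' ++ Q', (isWalk_append _).2 ⟨v, hP', hQ'⟩, List.map_append⟩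

theorem IsWalk.move (w : Deck p) {u v : Γ.CoverVertex p} {Q : List (Γ.CoverEdge p × Bool)}
    (h : (Γ.coverGraph p).IsWalk u Q v) :
    (Γ.coverGraph p).IsWalk (moveVertex w u) (Q.map fun s => (moveEdge w s.1, s.2))
      (moveVertex w v) := by
  induction Q generalizing u with
  | nil => exact congrArg _ h
  | cons s Q ih =>
    obtain ⟨rfl, hQ⟩ := h
    rcases s with ⟨c, _ | _⟩ <;> exact ⟨rfl, ih hQ⟩

theorem HasLift.move (w : Deck p) {u v : Γ.CoverVertex p} {P : List (E × Bool)}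
    (h : HasLift p u P v) : HasLift p (moveVertex w u) P (moveVertex w v) := by
  obtain ⟨Q, hQ, rfl⟩ := h
  exact ⟨_, hQ.move w, by simp [word, moveEdge]⟩

/-- If `P` leads from `u` to `w u`, then `P ^ n` leads from `u` to `w ^ n u`. -/
theorem HasLift.pow {w : Deck p} {u : Γ.CoverVertex p} {P : List (E × Bool)}
    (h : HasLift p u P (moveVertex w u)) (n : ℕ) :
    HasLift p u (List.replicate n P).flatten (moveVertex (w ^ n) u) := by
  induction n with
  | zero => exact ⟨[], rfl, rfl⟩
  | succ n ih =>
    rw [List.replicate_succ, List.flatten_cons, pow_succ']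
    exact h.append (ih.move w)

variable (hp : IsCoveringMap p)
include hp

/-- Two traversed lifts of the same edge that start at the same vertex coincide. -/
theorem eq_of_start_eq {s t : Γ.CoverEdge p × Bool} (hb : s.1.base = t.1.base) (h2 : s.2 = t.2)
    (h : (Γ.coverGraph p).start s = (Γ.coverGraph p).start t) : s = t := by
  obtain ⟨c, b⟩ := s
  obtain ⟨d, b'⟩ := t
  obtain rfl : b = b' := h2
  cases b
  · exact congrArg (·, false) (coverEdge_ext hp hb (congrArg Subtype.val h : c.path 1 = d.path 1))
  · exact congrArg (·, true) (coverEdge_ext hp hb (congrArg Subtype.val h : c.path 0 = d.path 0))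

theorem eq_rev_of_start_eq {s t : Γ.CoverEdge p × Bool} (hb : s.1.base = t.1.base)
    (h2 : t.2 = !s.2) (h : (Γ.coverGraph p).start t = (Γ.coverGraph p).finish s) : t = rev s :=
  eq_of_start_eq hp hb.symm h2 (h.trans (start_rev _ s).symm)

theorem HasLift.red {u v : Γ.CoverVertex p} {P Q : List (E × Bool)} (h : HasLift p u P v)
    (hPQ : FreeGroup.Red P Q) : HasLift p u Q v := by
  induction hPQ with
  | refl => exact h
  | tail _ hstep ih =>
    obtain ⟨A, hA, hword⟩ := ih
    cases hstep with
    | @not L₁ L₂ e b =>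
      obtain ⟨A₁, A', rfl, hA₁, hA'⟩ := List.map_eq_append_iff.1 hword
      obtain ⟨s, A'', rfl, hs, hA''⟩ := List.map_eq_cons_iff.1 hA'
      obtain ⟨t, A₂, rfl, ht, hA₂⟩ := List.map_eq_cons_iff.1 hA''
      rw [Prod.mk.injEq] at hs ht
      obtain ⟨w, -, -, hst, -⟩ := (isWalk_append _).1 hA
      obtain rfl := eq_rev_of_start_eq hp (hs.1.trans ht.1.symm) (by rw [ht.2, hs.2]) hst
      refine ⟨A₁ ++ A₂, hA.cancel, ?_⟩
      rw [← hA₁, ← hA₂]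
      exact List.map_append

theorem isReduced_word {u v : Γ.CoverVertex p} {Q : List (Γ.CoverEdge p × Bool)}
    (h : (Γ.coverGraph p).IsWalk u Q v) (hQ : Reduced Q) : FreeGroup.IsReduced (word Q) := by
  refine List.isChain_iff_forall_rel_of_append_cons_cons.2 fun a b L₁ L₂ hword => ?_
  obtain ⟨A₁, A', rfl, hA₁, hA'⟩ := List.map_eq_append_iff.1 hword
  obtain ⟨s, A'', rfl, rfl, hA''⟩ := List.map_eq_cons_iff.1 hA'
  obtain ⟨t, A₂, rfl, rfl, hA₂⟩ := List.map_eq_cons_iff.1 hA''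
  obtain ⟨w, -, -, hst, -⟩ := (isWalk_append _).1 h
  intro hb
  by_contra hne
  refine List.isChain_iff_forall_rel_of_append_cons_cons.1 hQ rfl
    (eq_rev_of_start_eq hp hb ?_ hst)
  exact Bool.eq_not.2 (Ne.symm hne)

omit hp in
theorem reduced_of_isReduced_word {Q : List (Γ.CoverEdge p × Bool)}
    (h : FreeGroup.IsReduced (word Q)) : Reduced Q := by
  refine List.isChain_of_isChain_map _ (fun s t hst => ?_) h
  rintro rfl
  have := hst rfl
  simp [rev] at this

/-! ### The covering graph is a tree -/

/-- An edge other than `c` does not cross `c`: both its ends are on the same side of `c`. -/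
theorem side_start_iff {c : Γ.CoverEdge p} {h : C(X, ℝ)} (H : IsHeight c.path h)
    {s : Γ.CoverEdge p × Bool} (hs : s.1 ≠ c) :
    1 ≤ h ((Γ.coverGraph p).start s).1 ↔ 1 ≤ h ((Γ.coverGraph p).finish s).1 := by
  have hav : ∀ x ∈ Set.range s.1.path, ¬ (0 < h x ∧ h x < 1) := by
    rintro _ ⟨t, rfl⟩ ⟨h0, h1⟩
    obtain ⟨r, hr⟩ := H.mem_arc _ h0 h1
    rw [hr, H.on_arc] at h0 h1
    exact hs (coverEdge_ext_of_mem hp h0 h1 hr.symm).1.symm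
  have hmem : ∀ t, s.1.path t ∈ Set.range s.1.path := fun t => ⟨t, rfl⟩
  have hconn := isPreconnected_range s.1.path.continuous
  rcases s with ⟨d, _ | _⟩
  · exact ⟨IsHeight.one_le_of_isPreconnected hconn hav (hmem 1) (hmem 0),
      IsHeight.one_le_of_isPreconnected hconn hav (hmem 0) (hmem 1)⟩
  · exact ⟨IsHeight.one_le_of_isPreconnected hconn hav (hmem 0) (hmem 1),
      IsHeight.one_le_of_isPreconnected hconn hav (hmem 1) (hmem 0)⟩

theorem side_walk_iff {c : Γ.CoverEdge p} {h : C(X, ℝ)} (H : IsHeight c.path h)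
    {u v : Γ.CoverVertex p} {Q : List (Γ.CoverEdge p × Bool)}
    (hQ : (Γ.coverGraph p).IsWalk u Q v) (hc : ∀ s ∈ Q, s.1 ≠ c) : 1 ≤ h u.1 ↔ 1 ≤ h v.1 := by
  induction Q generalizing u with
  | nil => rw [show u = v from hQ]
  | cons s Q ih =>
    obtain ⟨rfl, hQ⟩ := hQ
    exact (side_start_iff hp H (hc s (by simp))).trans (ih hQ fun t ht => hc t (by simp [ht]))

omit hp in
theorem IsHeight.start_iff {c : Γ.CoverEdge p} {h : C(X, ℝ)} (H : IsHeight c.path h) (b : Bool) :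
    1 ≤ h ((Γ.coverGraph p).start (c, b)).1 ↔ b = false := by
  have h0 := H.on_arc 0
  have h1 := H.on_arc 1
  cases b
  · exact iff_of_true h1.ge rfl
  · exact iff_of_false (not_le.2 (h0.trans_lt one_pos)) (by simp)

omit hp in
theorem IsHeight.finish_iff {c : Γ.CoverEdge p} {h : C(X, ℝ)} (H : IsHeight c.path h) (b : Bool) :
    1 ≤ h ((Γ.coverGraph p).finish (c, b)).1 ↔ b = true := by
  rw [← start_rev]
  exact (H.start_iff (!b)).trans (by simp)

/-- A reduced edge path in the universal covering never returns to its first edge: otherwise it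
would come back to the end point of that edge, along a shorter reduced path with the same
defect. -/
theorem first_edge_not_mem [SimplyConnectedSpace X] {u v : Γ.CoverVertex p}
    {s : Γ.CoverEdge p × Bool} {Q : List (Γ.CoverEdge p × Bool)}
    (h : (Γ.coverGraph p).IsWalk u (s :: Q) v) (hred : Reduced (s :: Q)) :
    ∀ t ∈ Q, t.1 ≠ s.1 := by
  induction hn : Q.length using Nat.strong_induction_on generalizing u v s Q with
  | _ n ih =>
  subst hn
  by_contra hex
  push Not at hex
  obtain ⟨Q₁, b, Q₂, rfl, hQ₁⟩ := exists_first_use hex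
  obtain ⟨c, a⟩ := s
  obtain ⟨-, hQ⟩ := h
  obtain ⟨x, hw₁, hx, -⟩ := (isWalk_append _).1 hQ
  obtain ⟨η, H⟩ := exists_isHeight hp c
  have hside := side_walk_iff hp H hw₁ hQ₁
  rw [H.finish_iff, ← hx, H.start_iff] at hside
  obtain rfl : b = !a := by cases a <;> cases b <;> simp_all
  rcases Q₁ with _ | ⟨t, Q₁⟩
  · exact List.isChain_iff_forall_rel_of_append_cons_cons.1 hred (l₁ := []) rfl rfl
  · have hred' : Reduced (t :: Q₁) := hred.infix ⟨[(c, a)], (c, !a) :: Q₂, by simp⟩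
    have hnot := ih Q₁.length (by simp) hw₁ hred' rfl
    obtain ⟨η', H'⟩ := exists_isHeight hp t.1
    have hside' := side_walk_iff hp H' hw₁.2 hnot
    have hxt : x = (Γ.coverGraph p).start t := by
      rw [hw₁.1, ← hx]
      exact start_rev _ (c, a)
    rw [hxt, H'.finish_iff t.2, H'.start_iff t.2] at hside'
    cases ht : t.2 <;> simp [ht] at hside'

/-- A reduced path whose first edge crosses `c` ends on the side of `c` that it then enters. -/
theorem side_end_iff [SimplyConnectedSpace X] {u v : Γ.CoverVertex p}
    {c : Γ.CoverEdge p} {b : Bool} {Q : List (Γ.CoverEdge p × Bool)} {h : C(X, ℝ)}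
    (H : IsHeight c.path h) (hw : (Γ.coverGraph p).IsWalk u ((c, b) :: Q) v)
    (hred : Reduced ((c, b) :: Q)) : 1 ≤ h v.1 ↔ b = true := by
  rw [← side_walk_iff hp H hw.2 (first_edge_not_mem hp hw hred), H.finish_iff]

/-! ### Powers of a covering transformation -/

omit hp in
open FreeGroup FreeGroup.reduceCyclically in
/-- A power of a reduced word, once reduced, begins with the same letter. -/
theorem head?_reduce_flatten_replicate {α : Type*} [DecidableEq α] {P : List (α × Bool)}
    (hP : IsReduced P) {n : ℕ} (hn : 0 < n) :
    (reduce (List.replicate n P).flatten).head? = P.head? := by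
  obtain ⟨n, rfl⟩ : ∃ k, n = k + 1 := ⟨n - 1, by omega⟩
  rw [reduce_flatten_replicate_succ hP]
  conv_rhs => rw [← conj_conjugator_reduceCyclically P]
  rcases hA : conjugator P with _ | ⟨a, A⟩
  · rcases hC : reduceCyclically P with _ | ⟨b, C⟩
    · simp
    · simp [List.replicate_succ]
  · simp

/-- If the reduced path from `u` to `w u` begins by crossing `c`, then every forward power of `w`
moves `u` to the other side of `c`. -/
theorem side_pow_iff [SimplyConnectedSpace X] {w : Deck p} {u : Γ.CoverVertex p}
    {c : Γ.CoverEdge p} {b : Bool} {Q : List (Γ.CoverEdge p × Bool)} {h : C(X, ℝ)}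
    (H : IsHeight c.path h) (hw : (Γ.coverGraph p).IsWalk u ((c, b) :: Q) (moveVertex w u))
    (hred : Reduced ((c, b) :: Q)) {n : ℕ} (hn : 0 < n) :
    1 ≤ h ((w ^ n).1 u.1) ↔ b = true := by
  classical
  have hredw := isReduced_word hp hw hred
  have hlift : HasLift p u _ (moveVertex w u) := ⟨_, hw, rfl⟩
  obtain ⟨R, hR, hRword⟩ := (hlift.pow n).red hp FreeGroup.reduce.red
  have hRred : Reduced R := reduced_of_isReduced_word <| by
    rw [hRword]
    exact FreeGroup.IsReduced.of_reduce_eq FreeGroup.reduce.idem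
  have hhead : (word R).head? = some (c.base, b) := by
    rw [hRword, head?_reduce_flatten_replicate hredw hn]
    rfl
  rcases R with _ | ⟨s, R⟩
  · simp [word] at hhead
  · simp only [word, List.map_cons, List.head?_cons, Option.some.injEq, Prod.mk.injEq] at hhead
    obtain rfl : s = (c, b) := eq_of_start_eq hp hhead.1 hhead.2 (hR.1.trans hw.1.symm)
    exact side_end_iff hp H hR hRred

end Cover

/-! ### Rotation elements -/

section Rotation

variable {V E X : Type*} [TopologicalSpace X] {Γ : Multigraph V E} {p : X → Γ.Space}

theorem deck_pow_apply (w : Deck p) (k : ℕ) (x : X) : (w ^ k).1 x = w.1^[k] x := by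
  induction k generalizing x with
  | zero => rfl
  | succ k ih =>
    rw [pow_succ, Function.iterate_succ_apply, ← ih]
    rfl

theorem ratPow_pow {π : Type*} [Group π] (w : π) (k : ℕ) (q : ℚ) :
    ratPow (w ^ k) q = ratPow w (k * q) := by
  have := Quot.sound (PowRel.pow w (k : ℤ) q)
  rwa [zpow_natCast, Int.cast_natCast] at this

/-- Vertices of the covering do not lie in the interior of a lifted edge. -/
theorem IsHeight.le_zero_of_vertex {c : Γ.CoverEdge p} {h : C(X, ℝ)} (H : IsHeight c.path h)
    (x : Γ.CoverVertex p) (hx : ¬ 1 ≤ h x.1) : h x.1 ≤ 0 := by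
  by_contra h0
  obtain ⟨t, ht⟩ := H.mem_arc _ (not_le.1 h0) (not_le.1 hx)
  rw [ht, H.on_arc, not_le] at h0 hx
  obtain ⟨v, hv⟩ := x.2
  rw [ht, c.proj] at hv
  refine coe_ne_zero_of_mem_Ioo (t := t) h0 hx ?_
  rw [← Γ.edgeCoord_edgePt c.base, hv]
  rfl

/-- The rotation elements `w₁ ^ q` with `0 ≤ q < 1 / m` are realized on an arc whose end points are
periodic with rotation elements `w₁ ^ (1 / m)` and `w₂ ^ (1 / n)` and move across the arc. The two
periods are made equal by passing to the iterate `F ^ (m n)`. -/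
theorem IsHeight.exists_rotation [PreconnectedSpace X] {a : C(I, X)} {h : C(X, ℝ)}
    (H : IsHeight a h)
    (hav : ∀ w : Deck p, w ≠ 1 → ∀ s t : I, 0 < t → t < 1 → w.1 (a s) ≠ a t)
    (F : C(X, X)) (hcomm : ∀ (g : Deck p) (x : X), F (g.1 x) = g.1 (F x))
    {m n : ℕ} (hm : 0 < m) (hn : 0 < n) {w₁ w₂ : Deck p}
    (h₁ : F^[m] (a 0) = w₁.1 (a 0)) (h₂ : F^[n] (a 1) = w₂.1 (a 1))
    (hs₁ : ∀ k, 0 < k → 1 ≤ h ((w₁ ^ k).1 (a 0))) (hs₂ : ∀ k, 0 < k → h ((w₂ ^ k).1 (a 1)) ≤ 0)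
    {q : ℚ} (hq₀ : 0 ≤ q) (hq : q < 1 / (m : ℚ)) :
    ∃ t : I, 0 < t ∧ t < 1 ∧ ∃ N : ℕ, 0 < N ∧ ∃ w : Deck p,
      F^[N] (a t) = w.1 (a t) ∧ ratPow w₁ q = ratPow w (1 / (N : ℚ)) := by
  have hm' : (0 : ℚ) < m := by exact_mod_cast hm
  have hn' : (0 : ℚ) < n := by exact_mod_cast hn
  obtain ⟨j, k, hk, hjk, hqm⟩ : ∃ j k : ℕ, 0 < k ∧ j < k ∧ q * m = j / k := by
    have h0 : 0 ≤ q * m := mul_nonneg hq₀ hm'.le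
    have h1 : q * m < 1 := (lt_div_iff₀ hm').1 hq
    have hnum : ((q * m).num.toNat : ℤ) = (q * m).num := Int.toNat_of_nonneg (Rat.num_nonneg.2 h0)
    refine ⟨(q * m).num.toNat, (q * m).den, Rat.den_pos _, ?_, ?_⟩
    · rw [← Int.ofNat_lt, hnum]
      rw [← Rat.num_div_den (q * m), div_lt_one (by exact_mod_cast Rat.den_pos _)] at h1
      exact_mod_cast h1
    · rw [← Int.cast_natCast (q * m).num.toNat, hnum, Rat.num_div_den]
  have hk' : (0 : ℚ) < k := by exact_mod_cast hk
  have hiter : ∀ (w : Deck p) (i : ℕ) (x : X), F^[i] (w.1 x) = w.1 (F^[i] x) := fun w i x =>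
    Function.Commute.iterate_left (f := F) (g := w.1) (hcomm w) i x
  have hpow : ∀ (w : Deck p) (i l : ℕ) (x : X), F^[i] x = w.1 x →
      F^[i * l] x = (w ^ l).1 x := fun w i l x hx => by
    rw [Function.iterate_mul, deck_pow_apply]
    induction l with
    | zero => rfl
    | succ l ih =>
      rw [Function.iterate_succ_apply', ih, Function.iterate_succ_apply, ← hx]
      exact (Function.Commute.iterate_right (f := F^[i]) (g := w.1) (hiter w i) l) x
  have hu1 : w₁ ^ n ≠ 1 := fun h1 => by
    have := hs₁ n hn
    rw [h1, show (1 : Deck p).1 (a 0) = a 0 from rfl, H.on_arc, Set.Icc.coe_zero] at this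
    linarith
  obtain ⟨t, ht0, ht1, ht⟩ := H.exists_periodic ⟨F^[m * n], F.continuous.iterate _⟩
    (w₁ ^ n).1 (w₂ ^ m).1 (hiter _ _) (hiter _ _) (hpow _ _ _ _ h₁)
    (by rw [mul_comm]; exact hpow _ _ _ _ h₂) (hav _ hu1)
    (hav (w₁ ^ n)⁻¹ (inv_ne_one.2 hu1))
    (fun i hi => by
      rw [← deck_pow_apply, ← pow_mul]
      exact hs₁ _ (Nat.mul_pos hn hi))
    (fun i hi => by
      rw [← deck_pow_apply, ← pow_mul]
      exact hs₂ _ (Nat.mul_pos hm hi)) j k hjk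
  refine ⟨t, ht0, ht1, m * n * (2 * k), by positivity, w₁ ^ (n * (2 * j)), ?_, ?_⟩
  · rw [Function.iterate_mul, pow_mul, deck_pow_apply]
    exact ht
  · rw [ratPow_pow]
    congr 1
    push_cast
    field_simp at hqm ⊢
    linear_combination hqm

theorem CoherentLabeling.lift_edgePt (L : Γ.CoherentLabeling p) {e : E} {t : I} (h0 : 0 < t)
    (h1 : t < 1) : L.lift (Γ.edgePt e t) = (L.edge e).path t :=
  (if_neg h0.ne').trans (if_neg h1.ne)

theorem CoherentLabeling.isPeriodicWithRotation_edgePt (L : Γ.CoherentLabeling p)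
    {f : C(Γ.Space, Γ.Space)} {F : C(X, X)} (hF : ∀ x, p (F x) = f (p x)) {e : E} {t : I}
    (h0 : 0 < t) (h1 : t < 1) {N : ℕ} (hN : 0 < N) {w : Deck p} {ρ : RatPow (Deck p)}
    (hw : F^[N] ((L.edge e).path t) = w.1 ((L.edge e).path t))
    (hρ : ρ = ratPow w (1 / (N : ℚ))) :
    L.IsPeriodicWithRotation f F (Γ.edgePt e t) ρ := by
  have hlift := L.lift_edgePt (e := e) h0 h1
  refine ⟨N, hN, ?_, w, by rw [hlift, hw], hρ⟩
  have hsemi : Function.Semiconj p F f := hF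
  have := hsemi.iterate_right N (L.lift (Γ.edgePt e t))
  rwa [hlift, hw, w.2, ← hlift, L.proj_lift, eq_comm] at this

end Rotation

end Multigraph

theorem mainTheorem5 {V E X : Type*} [Finite V] [Finite E] [TopologicalSpace X]
    -- the finite graph and its universal covering, coherently labeled
    (Γ : Multigraph V E) (hΓ : Γ.Loopless)
    [SimplyConnectedSpace X] (p : X → Γ.Space) (hp : IsCoveringMap p)
    (L : Γ.CoherentLabeling p)
    -- a vertex map homotopic to the identity
    (f : C(Γ.Space, Γ.Space)) (hf : f.Homotopic (ContinuousMap.id Γ.Space))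
    (hperm : ∃ τ : Equiv.Perm V, ∀ v, f (Γ.vertexPt v) = Γ.vertexPt (τ v))
    -- a lift of it that commutes with the covering transformations
    (F : C(X, X)) (hF : ∀ x, p (F x) = f (p x))
    (hcomm : ∀ (g : Multigraph.Deck p) (x : X), F (g.1 x) = g.1 (F x))
    -- an edge of the spanning tree, and its two periodic end points
    (e : E) (he : e ∈ L.tree) (m n : ℕ) (hm : 0 < m) (hn : 0 < n)
    (w₁ w₂ : Multigraph.Deck p)
    (hm_fix : f^[m] (Γ.vertexPt (Γ.src e)) = Γ.vertexPt (Γ.src e))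
    (hw₁ : F^[m] (L.vert (Γ.src e)).1 = w₁.1 (L.vert (Γ.src e)).1)
    (hn_fix : f^[n] (Γ.vertexPt (Γ.tgt e)) = Γ.vertexPt (Γ.tgt e))
    (hw₂ : F^[n] (L.vert (Γ.tgt e)).1 = w₂.1 (L.vert (Γ.tgt e)).1)
    -- the shortest paths from the end points to their translates
    (P₁ P₂ : List (Γ.CoverEdge p × Bool))
    (hP₁ : (Γ.coverGraph p).IsShortestWalk (L.vert (Γ.src e)) P₁
      (Multigraph.moveVertex w₁ (L.vert (Γ.src e))))
    (hP₂ : (Γ.coverGraph p).IsShortestWalk (L.vert (Γ.tgt e)) P₂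
      (Multigraph.moveVertex w₂ (L.vert (Γ.tgt e))))
    -- the edge belongs to both words, and both paths begin with it
    (hb₁ : L.Belongs e w₁) (hb₂ : L.Belongs e w₂)
    (hs₁ : Multigraph.BeginsWith P₁ (L.edge e)) (hs₂ : Multigraph.BeginsWith P₂ (L.edge e))
    (r s : ℚ) (hr₀ : 0 ≤ r) (hr : r < 1 / (m : ℚ)) (hs₀ : 0 ≤ s) (hs : s < 1 / (n : ℚ)) :
    (∃ x ∈ Γ.edgeSet e, L.IsPeriodicWithRotation f F x (Multigraph.ratPow w₁ r)) ∧
    (∃ y ∈ Γ.edgeSet e, L.IsPeriodicWithRotation f F y (Multigraph.ratPow w₂ s)) := by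
  set c := L.edge e with hc
  obtain ⟨h, H⟩ := Multigraph.exists_isHeight hp c
  have hsrc : (Γ.coverGraph p).start (c, true) = L.vert (Γ.src e) := L.edge_src e
  have htgt : (Γ.coverGraph p).start (c, false) = L.vert (Γ.tgt e) := L.edge_tgt e he
  have hc0 : c.path 0 = (L.vert (Γ.src e)).1 := congrArg Subtype.val hsrc
  have hc1 : c.path 1 = (L.vert (Γ.tgt e)).1 := congrArg Subtype.val htgt
  obtain ⟨b₁, Q₁, rfl⟩ := hs₁
  obtain ⟨b₂, Q₂, rfl⟩ := hs₂
  -- The paths start at the two different ends of the edge, which fixes their directions.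
  obtain rfl : b₁ = true := by
    have hstart := H.start_iff b₁
    rw [hP₁.1.1, ← hsrc, H.start_iff true] at hstart
    simpa using hstart
  obtain rfl : b₂ = false := by
    have hstart := H.start_iff b₂
    rw [hP₂.1.1, ← htgt, H.start_iff false] at hstart
    simpa using hstart
  have hs₁ : ∀ k, 0 < k → 1 ≤ h ((w₁ ^ k).1 (c.path 0)) := fun k hk => by
    rw [hc0]
    exact (Multigraph.side_pow_iff hp H hP₁.1 hP₁.reduced hk).2 rfl
  have hs₂ : ∀ k, 0 < k → h ((w₂ ^ k).1 (c.path 1)) ≤ 0 := fun k hk => by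
    rw [hc1]
    refine H.le_zero_of_vertex (Multigraph.moveVertex (w₂ ^ k) (L.vert (Γ.tgt e))) fun h1 => ?_
    simpa using (Multigraph.side_pow_iff hp H hP₂.1 hP₂.reduced hk).1 h1
  rw [← hc0] at hw₁
  rw [← hc1] at hw₂
  constructor
  · obtain ⟨t, ht0, ht1, N, hN, w, hw, hρ⟩ := H.exists_rotation
      (fun w hw s t => Multigraph.deck_path_ne hp hw c) F hcomm hm hn hw₁ hw₂ hs₁ hs₂ hr₀ hr
    exact ⟨_, ⟨t, rfl⟩, L.isPeriodicWithRotation_edgePt hF ht0 ht1 hN hw hρ⟩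
  · obtain ⟨t, ht0, ht1, N, hN, w, hw, hρ⟩ := H.symm.exists_rotation
      (fun w hw s t h0 h1 => Multigraph.deck_path_ne hp hw c (s := σ s) (t := σ t)
        (unitInterval.lt_symm_comm.2 (by simpa)) (unitInterval.symm_lt_comm.2 (by simpa))) F hcomm hn hm
      (w₁ := w₂) (w₂ := w₁) (by simpa using hw₂) (by simpa using hw₁)
      (fun k hk => by simpa using hs₂ k hk) (fun k hk => by simpa using hs₁ k hk) hs₀ hs
    exact ⟨_, ⟨σ t, rfl⟩, L.isPeriodicWithRotation_edgePt hF
      (unitInterval.lt_symm_comm.2 (by simpa)) (unitInterval.symm_lt_comm.2 (by simpa)) hN hw hρ⟩
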